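/- Let $W$ be a group. A subset $S\subseteq W$ is called a Coxeter generating set of $W$ if every element of $S$ has order $2$ and $W$ is given by the presentation $\langle S \mid (st)^{m_{s,t}}=1 \text{ for } s,t\in S \text{ with } m_{s,t}\neq\infty\rangle$, where $m_{s,t}\in\{1,2,\dots\}\cup\{\infty\}$ is the order of $st$ in $W$; the matrix $(m_{s,t})_{s,t\in S}$ is then called the type of $(W,S)$, and is said to be a type admitted by $W$. Two types $(m_{s,t})_{s,t\in S}$ and $(m'_{s',t'})_{s',t'\in S'}$ are isomorphic if there is a bijection $f:S\to S'$ with $m'_{f(s),f(t)}=m_{s,t}$ for all $s,t\in S$. The group $W$ is a right-angled Coxeter group if it admits a Coxeter generating set $S$, of finite or infinite cardinality, whose type has all its entries in $\{1,2,\infty\}$. Theorem. Every right-angled Coxeter group $W$, of finite or infinite rank, is rigid: all the types admitted by $W$ are isomorphic; equivalently, for any two Coxeter generating sets $S$ and $S'$ of $W$ there is an automorphism $\alpha$ of $W$ such that $\alpha(S)=S'$. -/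

import Mathlib

/-- The matrix `(m s t)` with `m s t` the order of `s * t`, for a set `S` of elements of order two.
As in Mathlib's Coxeter matrices, the entry `0` encodes `∞` (and `orderOf x = 0` if and only if
`x` has infinite order). -/
noncomputable def orderMatrix {W : Type*} [Group W] (S : Set W) (hS : ∀ s ∈ S, orderOf s = 2) :
    CoxeterMatrix S where
  M := Matrix.of fun s t : S => orderOf ((s : W) * (t : W))
  isSymm := by
    ext s t
    have hs : (s : W)⁻¹ = s := inv_eq_of_mul_eq_one_left (by
      rw [← pow_two, ← hS s s.2, pow_orderOf_eq_one])
    have ht : (t : W)⁻¹ = t := inv_eq_of_mul_eq_one_left (by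
      rw [← pow_two, ← hS t t.2, pow_orderOf_eq_one])
    show orderOf ((t : W) * (s : W)) = orderOf ((s : W) * (t : W))
    rw [← orderOf_inv, mul_inv_rev, hs, ht]
  diagonal s := by
    show orderOf ((s : W) * (s : W)) = 1
    rw [orderOf_eq_one_iff, ← pow_two, ← hS s s.2, pow_orderOf_eq_one]
  off_diagonal s t hst h := by
    have ht : (t : W)⁻¹ = t := inv_eq_of_mul_eq_one_left (by
      rw [← pow_two, ← hS t t.2, pow_orderOf_eq_one])
    have h1 : (s : W) * (t : W) = 1 := orderOf_eq_one_iff.mp h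
    exact hst (Subtype.ext ((eq_inv_of_mul_eq_one_left h1).trans ht))

/-- `S` is a Coxeter generating set of `W`: its elements have order two, and the inclusion of `S`
in `W` induces an isomorphism between the group presented by
`⟨S | (s t) ^ m s t = 1, for s, t ∈ S with m s t ≠ ∞⟩` and `W`, where `m s t` is the order of `s t`
in `W`. -/
structure IsCoxeterSet {W : Type*} [Group W] (S : Set W) : Prop where
  orderOf_eq_two : ∀ s ∈ S, orderOf s = 2
  presentation : ∃ cs : CoxeterSystem (orderMatrix S orderOf_eq_two) W, ∀ s : S, cs.simple s = s

/-- The type of the Coxeter system `(W, S)`. -/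
noncomputable def IsCoxeterSet.type {W : Type*} [Group W] {S : Set W} (hS : IsCoxeterSet S) : CoxeterMatrix S :=
  orderMatrix S hS.orderOf_eq_two

/-- A Coxeter matrix is right-angled if its entries belong to `{1, 2, ∞}` (`0` encodes `∞`). -/
def CoxeterMatrix.IsRightAngled {B : Type*} (M : CoxeterMatrix B) : Prop :=
  ∀ i j, M i j = 1 ∨ M i j = 2 ∨ M i j = 0

/-- Two Coxeter matrices are isomorphic if some bijection between the index sets respects the
entries. -/
def CoxeterMatrix.Isomorphic {B B' : Type*} (M : CoxeterMatrix B) (M' : CoxeterMatrix B') : Prop :=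
  ∃ e : B ≃ B', ∀ i j, M' (e i) (e j) = M i j

/-- `W` is a right-angled Coxeter group: it admits a Coxeter system of right-angled type. -/
def IsRightAngledCoxeterGroup (W : Type*) [Group W] : Prop :=
  ∃ (S : Set W) (hS : IsCoxeterSet S), hS.type.IsRightAngled

/-- `W` is rigid: all the types that `W` admits are isomorphic. -/
def IsRigid (W : Type*) [Group W] : Prop :=
  ∀ (S S' : Set W) (hS : IsCoxeterSet S) (hS' : IsCoxeterSet S'), hS.type.Isomorphic hS'.type

/-- The action of a simple reflection on integer labels: the label at `s` changes sign, and twice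
its value is added to the labels at the `t` with `m s t = ∞`. -/
def CoxeterMatrix.wallAction {B : Type*} [DecidableEq B] (M : CoxeterMatrix B) (s : B) :
    Function.End (B → ℤ) :=
  fun c t => if t = s then -c s else if M s t = 0 then c t + 2 * c s else c t

theorem CoxeterMatrix.IsRightAngled.isLiftable_wallAction {B : Type*} [DecidableEq B]
    {M : CoxeterMatrix B} (hM : M.IsRightAngled) : M.IsLiftable M.wallAction := by
  have hsq : ∀ s, M.wallAction s * M.wallAction s = 1 := by
    intro s
    funext c t
    have h1 := M.diagonal s
    change M.wallAction s (M.wallAction s c) t = c t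
    unfold wallAction
    by_cases hts : t = s
    · simp [hts]
    · simp only [hts, if_false, if_true]
      split_ifs <;> ring
  intro s t
  rcases hM s t with h | h | h
  · have : s = t := by
      by_contra hne
      exact M.off_diagonal s t hne h
    subst this
    rw [hsq, one_pow]
  · have hcomm : M.wallAction s * M.wallAction t = M.wallAction t * M.wallAction s := by
      have h' : M t s = 2 := by rw [M.symmetric t s, h]
      have hst : s ≠ t := by
        rintro rfl
        simp at h
      funext c u
      change M.wallAction s (M.wallAction t c) u = M.wallAction t (M.wallAction s c) u
      unfold wallAction
      by_cases hus : u = s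
      · simp [hus, hst, h']
      · by_cases hut : u = t
        · simp [hut, h, hst.symm]
        · simp only [hus, hut, hst, hst.symm, h, h', if_false]
          norm_num
          split_ifs <;> ring
    rw [h, pow_two, mul_assoc, ← mul_assoc (M.wallAction t), ← hcomm, mul_assoc (M.wallAction s),
      hsq, mul_one, hsq]
  · rw [h, pow_zero]

namespace CoxeterSystem

variable {B W : Type*} [Group W] {M : CoxeterMatrix B}

/-- The product `s (f (n - 1)) * ⋯ * s (f 0)` of simple reflections. -/
def revProd (cs : CoxeterSystem M W) (f : ℕ → B) : ℕ → W
  | 0 => 1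
  | n + 1 => cs.simple (f n) * revProd cs f n

theorem revProd_add (cs : CoxeterSystem M W) (f : ℕ → B) (m n : ℕ) :
    cs.revProd f (m + n) = cs.revProd (fun k => f (m + k)) n * cs.revProd f m := by
  induction n with
  | zero => simp [revProd]
  | succ n ih => rw [← add_assoc, revProd, ih, revProd, mul_assoc]

theorem revProd_one (cs : CoxeterSystem M W) (f : ℕ → B) :
    cs.revProd f 1 = cs.simple (f 0) := by
  simp [revProd]

theorem revProd_congr (cs : CoxeterSystem M W) {f g : ℕ → B} {n : ℕ}
    (h : ∀ k < n, f k = g k) : cs.revProd f n = cs.revProd g n := by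
  induction n with
  | zero => rfl
  | succ n ih => rw [revProd, revProd, h n n.lt_succ_self, ih fun k hk => h k (by omega)]

theorem length_revProd_le (cs : CoxeterSystem M W) (f : ℕ → B) (n : ℕ) :
    cs.length (cs.revProd f n) ≤ n := by
  induction n with
  | zero => simp [revProd]
  | succ n ih =>
    have := cs.length_mul_le (cs.simple (f n)) (cs.revProd f n)
    rw [cs.length_simple] at this
    rw [revProd]
    omega

theorem exists_revProd_eq [Nonempty B] (cs : CoxeterSystem M W) (w : W) :
    ∃ f : ℕ → B, cs.revProd f (cs.length w) = w := by
  obtain ⟨l, hl, hw⟩ := cs.exists_isReduced w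
  have key : ∀ l : List B, ∃ f : ℕ → B, cs.revProd f l.length = cs.wordProd l := by
    intro l
    induction l with
    | nil => exact ⟨fun _ => Classical.arbitrary B, by simp [revProd]⟩
    | cons s l ih =>
      obtain ⟨f, hf⟩ := ih
      refine ⟨fun k => if k < l.length then f k else s, ?_⟩
      rw [List.length_cons, revProd, cs.wordProd_cons, ← hf]
      congr 1
      · simp
      · exact cs.revProd_congr fun k hk => by simp [hk]
  obtain ⟨f, hf⟩ := key l
  exact ⟨f, by rw [hw, hl.eq, hf]⟩

theorem revProd_period_mul (cs : CoxeterSystem M W) {f : ℕ → B} {n : ℕ}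
    (hf : ∀ k, f (n + k) = f k) (m : ℕ) : cs.revProd f (n * m) = cs.revProd f n ^ m := by
  induction m with
  | zero => simp [revProd]
  | succ m ih =>
    rw [mul_add_one, add_comm, cs.revProd_add, pow_succ, ← ih]
    simp only [hf]

theorem simple_commute (cs : CoxeterSystem M W) {s t : B} (h : M s t = 2) :
    Commute (cs.simple s) (cs.simple t) := by
  have := cs.simple_mul_simple_pow s t
  rw [h, pow_two] at this
  have := eq_inv_of_mul_eq_one_left this
  simpa [Commute, SemiconjBy] using this

theorem simple_commute_of_ne_zero (cs : CoxeterSystem M W) (hM : M.IsRightAngled) {s t : B}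
    (h : M s t ≠ 0) : Commute (cs.simple s) (cs.simple t) := by
  rcases hM s t with h1 | h2 | h0
  · have : s = t := by
      by_contra hne
      exact M.off_diagonal s t hne h1
    rw [this]
  · exact cs.simple_commute h2
  · exact absurd h0 h

theorem commute_revProd (cs : CoxeterSystem M W) {x : W} {f : ℕ → B} {n : ℕ}
    (h : ∀ k < n, Commute x (cs.simple (f k))) : Commute x (cs.revProd f n) := by
  induction n with
  | zero => exact Commute.one_right x
  | succ n ih => exact (h n n.lt_succ_self).mul_right (ih fun k hk => h k (by omega))

/-- A word representing the identity contains a letter that can be moved next to a later occurrence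
of itself. -/
theorem exists_cancelling_pair (cs : CoxeterSystem M W) (hM : M.IsRightAngled) {f : ℕ → B} {n : ℕ}
    (hn : 0 < n) (hf : cs.revProd f n = 1) :
    ∃ i k, i < k ∧ f i = f k ∧ ∀ j, i < j → j < k → M (f j) (f k) ≠ 0 := by
  classical
  by_contra! hbad
  let ρ : W →* Function.End (B → ℤ) := cs.lift ⟨M.wallAction, hM.isLiftable_wallAction⟩
  let c : ℕ → B → ℤ := fun k => ρ (cs.revProd f k) 1
  have hc : ∀ k, c (k + 1) = M.wallAction (f k) (c k) := by
    intro k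
    change ρ (cs.simple (f k) * cs.revProd f k) 1 = _
    rw [map_mul]
    change ρ (cs.simple (f k)) (c k) = _
    rw [show ρ (cs.simple (f k)) = M.wallAction (f k) from cs.lift_apply_simple _ _]
  have hc0 : c 0 = 1 := by
    change ρ 1 1 = _
    rw [map_one]
    rfl
  have key : ∀ k, (∀ s t, M s t = 0 → 0 < c k s + c k t) ∧
      ∀ s, c k s ≤ 0 → ∃ i < k, f i = s ∧ ∀ j, i < j → j < k → M (f j) s ≠ 0 := by
    intro k
    induction k with
    | zero => simp [hc0]
    | succ k ih =>
      obtain ⟨ih1, ih2⟩ := ih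
      have hpos : 0 < c k (f k) := by
        by_contra! h
        obtain ⟨i, hi, hik, hj⟩ := ih2 _ h
        obtain ⟨j, hj1, hj2, hj3⟩ := hbad i k hi hik
        exact hj j hj1 hj2 hj3
      have hd : ∀ s, M s s ≠ 0 := fun s => by simp
      rw [hc]
      constructor
      · intro s t hst
        have h0 := ih1 s t hst
        have hne : s ≠ t := by rintro rfl; exact hd _ hst
        have hts : M t s = 0 := by rw [M.symmetric t s, hst]
        unfold CoxeterMatrix.wallAction
        by_cases hs : s = f k
        · rw [← hs] at hpos ⊢
          simp only [if_true, hne.symm, hst, if_false]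
          linarith
        · by_cases ht : t = f k
          · rw [← ht] at hpos ⊢
            simp only [if_true, hne, hts, if_false]
            linarith
          · simp only [hs, ht, if_false]
            split_ifs <;> linarith
      · intro s hs
        unfold CoxeterMatrix.wallAction at hs
        by_cases hsk : s = f k
        · exact ⟨k, k.lt_succ_self, hsk.symm, fun j h1 h2 => by omega⟩
        · simp only [hsk, if_false] at hs
          split_ifs at hs with h0
          · have := ih1 _ _ h0
            linarith
          · obtain ⟨i, hi, his, hj⟩ := ih2 s hs
            refine ⟨i, by omega, his, fun j h1 h2 => ?_⟩
            rcases Nat.lt_succ_iff_lt_or_eq.mp h2 with h3 | rfl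
            · exact hj j h1 h3
            · exact h0
  obtain ⟨m, rfl⟩ : ∃ m, n = m + 1 := ⟨n - 1, by omega⟩
  have hpos : 0 < c m (f m) := by
    by_contra! h
    obtain ⟨i, hi, hik, hj⟩ := (key m).2 _ h
    obtain ⟨j, hj1, hj2, hj3⟩ := hbad i m hi hik
    exact hj j hj1 hj2 hj3
  have h1 : c (m + 1) = 1 := by
    change ρ (cs.revProd f (m + 1)) 1 = 1
    rw [hf, map_one]
    rfl
  have h2 := congrFun h1 (f m)
  rw [hc] at h2
  simp [CoxeterMatrix.wallAction] at h2
  linarith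

/-- Elements of finite order in a right-angled Coxeter group are involutions or trivial. -/
theorem mul_self_eq_one_of_isOfFinOrder (cs : CoxeterSystem M W) (hM : M.IsRightAngled) {w : W}
    (hw : IsOfFinOrder w) : w * w = 1 := by
  induction hn : cs.length w using Nat.strong_induction_on generalizing w with
  | _ n ih =>
    subst hn
    rcases Nat.eq_zero_or_pos (cs.length w) with h0 | hpos
    · rw [cs.length_eq_zero_iff.mp h0, one_mul]
    have hB : Nonempty B := by
      by_contra hB
      rw [not_nonempty_iff] at hB
      obtain ⟨l, rfl⟩ := cs.wordProd_surjective w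
      rw [List.eq_nil_of_length_eq_zero (l := l) (by
        cases l with
        | nil => rfl
        | cons s _ => exact hB.elim s)] at hpos
      simp at hpos
    set n := cs.length w with hn
    obtain ⟨f₀, hf₀⟩ := cs.exists_revProd_eq w
    obtain ⟨f, hf, hper⟩ : ∃ f : ℕ → B, cs.revProd f n = w ∧ ∀ k, f (n + k) = f k :=
      ⟨fun k => f₀ (k % n), by
        rw [← hf₀]
        exact cs.revProd_congr fun k hk => by rw [Nat.mod_eq_of_lt hk], fun k => by simp⟩
    obtain ⟨m, hm, hwm⟩ := hw.exists_pow_eq_one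
    rw [← hf, ← cs.revProd_period_mul hper] at hwm
    obtain ⟨i, d, hd, hdn, hid, hcomm⟩ : ∃ i d, 0 < d ∧ d ≤ n ∧ f i = f (i + d) ∧
        ∀ j, 0 < j → j < d → M (f (i + j)) (f i) ≠ 0 := by
      obtain ⟨i, k, hik, hfik, h⟩ := cs.exists_cancelling_pair hM (Nat.mul_pos hpos hm) hwm
      rw [← hfik] at h
      by_cases hk : k ≤ i + n
      · exact ⟨i, k - i, by omega, by omega, by rw [hfik]; congr 1; omega,
          fun j h1 h2 => h _ (by omega) (by omega)⟩
      · exact ⟨i, n, hpos, le_rfl, by rw [add_comm, hper],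
          fun j h1 h2 => h _ (by omega) (by omega)⟩
    let h : ℕ → B := fun k => f (i + k)
    have hconj : cs.revProd h n = cs.revProd f i * w * (cs.revProd f i)⁻¹ := by
      rw [eq_mul_inv_iff_mul_eq, ← cs.revProd_add, ← hf, add_comm, cs.revProd_add]
      simp only [hper]
    have hfin : IsOfFinOrder (cs.revProd h n) := by
      rw [hconj]
      exact (MulAut.conj (cs.revProd f i)).toMonoidHom.isOfFinOrder hw
    suffices hsq : cs.revProd h n * cs.revProd h n = 1 by
      rwa [hconj, conj_mul, conj_eq_one_iff] at hsq
    obtain ⟨d, rfl⟩ : ∃ e, d = e + 1 := ⟨d - 1, by omega⟩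
    set s := cs.simple (f i) with hs
    set Y := cs.revProd (fun k => f (i + (1 + k))) d with hY
    have hsY : Commute s Y := cs.commute_revProd fun k hk =>
      (cs.simple_commute_of_ne_zero hM (hcomm (1 + k) (by omega) (by omega))).symm
    have hss : s * s = 1 := cs.simple_mul_simple_self _
    have hYlen : cs.length Y ≤ d := cs.length_revProd_le _ _
    have hd1 : cs.revProd h (d + 1) = Y * s := by
      rw [add_comm, cs.revProd_add, cs.revProd_one]
      rfl
    rcases hdn.eq_or_lt with heq | hlt
    · rw [← heq, hd1] at hfin ⊢
      have hYfin : IsOfFinOrder Y := by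
        have : Y = Y * s * s := by rw [mul_assoc, hss, mul_one]
        rw [this]
        refine Commute.isOfFinOrder_mul ?_ hfin (isOfFinOrder_iff_pow_eq_one.mpr
          ⟨2, by norm_num, by rw [pow_two, hss]⟩)
        exact (hsY.symm.mul_left (Commute.refl s))
      have := ih _ (by omega) hYfin rfl
      rw [mul_assoc, ← mul_assoc s, hsY.eq, mul_assoc Y, hss, mul_one, this]
    · obtain ⟨e, he⟩ : ∃ e, n = d + 1 + 1 + e := ⟨n - (d + 1 + 1), by omega⟩
      set Z := cs.revProd (fun k => h (d + 1 + 1 + k)) e with hZ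
      have hprod : cs.revProd h n = Z * Y := by
        rw [he, cs.revProd_add, revProd, hd1, ← hsY.eq,
          show cs.simple (h (d + 1)) = s by rw [hs, hid], ← mul_assoc s, hss, one_mul]
      have hlen : cs.length (Z * Y) ≤ e + d :=
        (cs.length_mul_le _ _).trans (add_le_add (cs.length_revProd_le _ _) hYlen)
      rw [hprod] at hfin ⊢
      exact ih _ (by omega) hfin rfl

end CoxeterSystem

section

variable {K V B : Type*}

/-- The vectors `z` that are related by `Q` to all the vectors to which `x` is related. -/
def relClosure (Q : V → V → Prop) (x : V) : Set V := {z | ∀ y, Q x y → Q z y}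

theorem self_mem_relClosure (Q : V → V → Prop) (x : V) : x ∈ relClosure Q x := fun _ h => h

theorem relClosure_subset {Q : V → V → Prop} {x z : V} (h : z ∈ relClosure Q x) :
    relClosure Q z ⊆ relClosure Q x := fun _ hu y hy => hu y (h y hy)

variable [Field K] [AddCommGroup V] [Module K V]

variable (K) in
/-- The span of the closures properly contained in a given set. -/
def properSpan (Q : V → V → Prop) (E : Set V) : Submodule K V :=
  Submodule.span K {y | Q y y ∧ relClosure Q y ⊂ E}

/-- `Q` relates the vectors whose supports lie in a common clique of `R`. -/
def IsCliqueRel (b : Module.Basis B K V) (R : B → B → Prop) (Q : V → V → Prop) : Prop :=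
  ∀ x y, Q x y ↔ ∀ s t, (b.repr x s ≠ 0 ∨ b.repr y s ≠ 0) →
    (b.repr x t ≠ 0 ∨ b.repr y t ≠ 0) → R s t

namespace IsCliqueRel

variable {b : Module.Basis B K V} {R : B → B → Prop} {Q : V → V → Prop}

theorem symm (h : IsCliqueRel b R Q) {x y : V} (hxy : Q x y) : Q y x :=
  (h y x).2 fun s t hs ht => (h x y).1 hxy s t hs.symm ht.symm

theorem basis_iff (h : IsCliqueRel b R Q) (hr : ∀ s, R s s) (hs : ∀ s t, R s t → R t s) (s t : B) :
    Q (b s) (b t) ↔ R s t := by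
  classical
  rw [h]
  simp only [Module.Basis.repr_self, Finsupp.single_apply, ne_eq, ite_eq_right_iff, one_ne_zero,
    imp_false, not_not]
  constructor
  · intro H
    exact H s t (Or.inl rfl) (Or.inr rfl)
  · rintro H u v (rfl | rfl) (rfl | rfl)
    exacts [hr _, H, hs _ _ H, hr _]

theorem mem_relClosure_iff (h : IsCliqueRel b R Q) (hr : ∀ s, R s s) (hs : ∀ s t, R s t → R t s)
    {x : V} (hx : Q x x) (z : V) : z ∈ relClosure Q x ↔
      ∀ t, b.repr z t ≠ 0 → ∀ u, (∀ s, b.repr x s ≠ 0 → R s u) → R t u := by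
  classical
  constructor
  · intro hz t ht u hu
    have hxu : Q x (b u) := by
      rw [h]
      simp only [Module.Basis.repr_self, Finsupp.single_apply, ne_eq, ite_eq_right_iff, one_ne_zero,
        imp_false, not_not]
      rintro p q (hp | rfl) (hq | rfl)
      · exact (h x x).1 hx p q (Or.inl hp) (Or.inl hq)
      · exact hu p hp
      · exact hs _ _ (hu q hq)
      · exact hr _
    exact (h z (b u)).1 (hz _ hxu) t u (Or.inl ht) (Or.inr (by simp))
  · intro hz y hxy
    have hxy' := (h x y).1 hxy
    have key : ∀ t, b.repr z t ≠ 0 → ∀ p, b.repr x p ≠ 0 ∨ b.repr y p ≠ 0 → R t p :=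
      fun t ht p hp => hz t ht p fun s hs => hxy' s p (Or.inl hs) hp
    rw [h]
    rintro p q (hp | hp) (hq | hq)
    · exact hz p hp q fun s hs' => hs _ _ (key q hq s (Or.inl hs'))
    · exact key p hp q (Or.inr hq)
    · exact hs _ _ (key q hq p (Or.inr hp))
    · exact hxy' p q (Or.inr hp) (Or.inr hq)

theorem basis_mem_relClosure (h : IsCliqueRel b R Q) (hr : ∀ s, R s s)
    (hs : ∀ s t, R s t → R t s) {x z : V} (hx : Q x x) (hz : z ∈ relClosure Q x) {t : B}
    (ht : b.repr z t ≠ 0) : b t ∈ relClosure Q x := by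
  classical
  rw [h.mem_relClosure_iff hr hs hx] at hz ⊢
  intro u hu
  obtain rfl : t = u := by simpa [Finsupp.single_apply] using hu
  exact hz t ht

theorem properSpan_le (h : IsCliqueRel b R Q) (hr : ∀ s, R s s) (hs : ∀ s t, R s t → R t s)
    (E : Set V) {v : V} (hv : v ∈ properSpan K Q E) {t : B} (ht : relClosure Q (b t) = E) :
    b.repr v t = 0 := by
  refine Submodule.span_induction (p := fun v _ => b.repr v t = 0) ?_ ?_ ?_ ?_ hv
  · rintro y ⟨hy, hyE⟩
    by_contra hyt
    have := relClosure_subset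
      (h.basis_mem_relClosure hr hs hy (self_mem_relClosure Q y) hyt)
    rw [ht] at this
    exact hyE.2 this
  · simp
  · intro x y _ _ hx hy
    simp [hx, hy]
  · intro a x _ hx
    simp [hx]

theorem nonempty_basis_fiber (h : IsCliqueRel b R Q) (hr : ∀ s, R s s) (hs : ∀ s t, R s t → R t s)
    {x : V} (hx : Q x x) :
    Nonempty (Module.Basis {s : B // relClosure Q (b s) = relClosure Q x} K (Submodule.span K
      ((properSpan K Q (relClosure Q x)).mkQ '' relClosure Q x))) := by
  set E := relClosure Q x with hE
  let v : {s : B // relClosure Q (b s) = E} → V ⧸ properSpan K Q E :=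
    fun s => (properSpan K Q E).mkQ (b s)
  have hli : LinearIndependent K v := by
    have h1 : LinearIndependent K fun s : {s : B // relClosure Q (b s) = E} => b s :=
      b.linearIndependent.comp _ Subtype.val_injective
    refine h1.map ?_
    rw [Submodule.ker_mkQ, Submodule.disjoint_def]
    intro z hz hz'
    refine b.ext_elem fun t => ?_
    rw [map_zero, Finsupp.zero_apply]
    by_cases ht : relClosure Q (b t) = E
    · exact h.properSpan_le hr hs E hz' ht
    · refine Submodule.span_induction (p := fun z _ => b.repr z t = 0) ?_ ?_ ?_ ?_ hz
      · rintro _ ⟨s, rfl⟩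
        have : (s : B) ≠ t := by
          rintro rfl
          exact ht s.2
        simp [this]
      · simp
      · intro x y _ _ hx hy
        simp [hx, hy]
      · intro a x _ hx
        simp [hx]
  have hspan : Submodule.span K ((properSpan K Q E).mkQ '' E) =
      Submodule.span K (Set.range v) := by
    apply le_antisymm
    · rw [Submodule.span_le]
      rintro _ ⟨z, hz, rfl⟩
      rw [← b.linearCombination_repr z, Finsupp.linearCombination_apply, Finsupp.sum, map_sum]
      refine Submodule.sum_mem _ fun t ht => ?_
      rw [map_smul]
      refine Submodule.smul_mem _ _ ?_
      have htE := h.basis_mem_relClosure hr hs hx hz (Finsupp.mem_support_iff.mp ht)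
      by_cases heq : relClosure Q (b t) = E
      · exact Submodule.subset_span ⟨⟨t, heq⟩, rfl⟩
      · have : b t ∈ properSpan K Q E := Submodule.subset_span
          ⟨(h.basis_iff hr hs t t).2 (hr t), (relClosure_subset htE).ssubset_of_ne heq⟩
        rw [Submodule.mkQ_apply, (Submodule.Quotient.mk_eq_zero _).2 this]
        exact Submodule.zero_mem _
    · refine Submodule.span_mono ?_
      rintro _ ⟨s, rfl⟩
      exact ⟨b s, s.2.le (self_mem_relClosure Q (b s)), rfl⟩
  rw [hspan]
  exact ⟨Module.Basis.span hli⟩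

end IsCliqueRel

/-- Two bases for which the same pairs of vectors have supports in a common clique are indexed by
isomorphic graphs. -/
theorem exists_equiv_of_isCliqueRel {B' : Type*} {b : Module.Basis B K V} {b' : Module.Basis B' K V}
    {R : B → B → Prop} {R' : B' → B' → Prop} {Q : V → V → Prop}
    (h : IsCliqueRel b R Q) (hr : ∀ s, R s s) (hs : ∀ s t, R s t → R t s)
    (h' : IsCliqueRel b' R' Q) (hr' : ∀ s, R' s s) (hs' : ∀ s t, R' s t → R' t s) :
    ∃ e : B ≃ B', ∀ s t, R' (e s) (e t) ↔ R s t := by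
  have hfib : ∀ E : Set V, Nonempty ({s : B // relClosure Q (b s) = E} ≃
      {s : B' // relClosure Q (b' s) = E}) := by
    intro E
    by_cases hE : ∃ x, Q x x ∧ relClosure Q x = E
    · obtain ⟨x, hx, rfl⟩ := hE
      obtain ⟨c⟩ := h.nonempty_basis_fiber hr hs hx
      obtain ⟨c'⟩ := h'.nonempty_basis_fiber hr' hs' hx
      exact ⟨c.indexEquiv c'⟩
    · push Not at hE
      have : IsEmpty {s : B // relClosure Q (b s) = E} :=
        ⟨fun s => hE _ ((h.basis_iff hr hs s s).2 (hr s)) s.2⟩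
      have : IsEmpty {s : B' // relClosure Q (b' s) = E} :=
        ⟨fun s => hE _ ((h'.basis_iff hr' hs' s s).2 (hr' s)) s.2⟩
      exact ⟨Equiv.equivOfIsEmpty _ _⟩
  let φ := fun E => (hfib E).some
  let e : B ≃ B' := (Equiv.sigmaFiberEquiv fun s => relClosure Q (b s)).symm.trans
    ((Equiv.sigmaCongrRight φ).trans (Equiv.sigmaFiberEquiv fun s => relClosure Q (b' s)))
  have he : ∀ s, relClosure Q (b' (e s)) = relClosure Q (b s) := fun s => (φ _ ⟨s, rfl⟩).2
  have hcongr : ∀ {x x' y}, relClosure Q x = relClosure Q x' → (Q x y ↔ Q x' y) := by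
    intro x x' y hxx
    exact ⟨fun H => (hxx ▸ self_mem_relClosure Q x' : x' ∈ relClosure Q x) y H,
      fun H => (hxx ▸ self_mem_relClosure Q x : x ∈ relClosure Q x') y H⟩
  refine ⟨e, fun s t => ?_⟩
  rw [← h.basis_iff hr hs, ← h'.basis_iff hr' hs', hcongr (he s)]
  exact ⟨fun H => h.symm ((hcongr (he t)).1 (h.symm H)),
    fun H => h.symm ((hcongr (he t)).2 (h.symm H))⟩

end

namespace DihedralGroup

/-- The reduction modulo two of the integers. -/
abbrev zmodCast : ZMod 0 →+* ZMod 2 := ZMod.castHom (dvd_zero 2) (ZMod 2)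

/-- The parity homomorphism of the infinite dihedral group that is trivial on `sr 0`. -/
def evenParity : DihedralGroup 0 →* Multiplicative (ZMod 2) where
  toFun
    | r i => .ofAdd (zmodCast i)
    | sr i => .ofAdd (zmodCast i)
  map_one' := zmodCast.map_zero
  map_mul' := by
    rintro (i | i) (j | j)
    · exact zmodCast.map_add i j
    · change zmodCast (j - i) = zmodCast i + zmodCast j
      rw [map_sub, CharTwo.sub_eq_add, add_comm]
    · exact zmodCast.map_add i j
    · change zmodCast (j - i) = zmodCast i + zmodCast j
      rw [map_sub, CharTwo.sub_eq_add, add_comm]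

/-- The parity homomorphism of the infinite dihedral group that is trivial on `sr 1`. -/
def oddParity : DihedralGroup 0 →* Multiplicative (ZMod 2) where
  toFun
    | r i => .ofAdd (zmodCast i)
    | sr i => .ofAdd (zmodCast i + 1)
  map_one' := zmodCast.map_zero
  map_mul' := by
    rintro (i | i) (j | j)
    · exact zmodCast.map_add i j
    · change zmodCast (j - i) + 1 = zmodCast i + (zmodCast j + 1)
      rw [map_sub, CharTwo.sub_eq_add, add_comm (zmodCast j), add_assoc]
    · change zmodCast (i + j) + 1 = zmodCast i + 1 + zmodCast j
      rw [map_add, add_right_comm]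
    · change zmodCast (j - i) = zmodCast i + 1 + (zmodCast j + 1)
      rw [map_sub, CharTwo.sub_eq_add, add_add_add_comm, CharTwo.add_self_eq_zero, add_zero,
        add_comm]

theorem parity_eq_one_of_commute {a b : DihedralGroup 0} (ha : a * a = 1) (hb : b * b = 1)
    (hab : Commute a b) : oddParity a = 1 ∨ evenParity b = 1 := by
  have hr : ∀ i : ℤ, (r (n := 0) i) * r (n := 0) i = 1 → i = 0 := by
    intro i h
    have h : (i + i : ℤ) = 0 := r.inj h
    omega
  rcases a with i | i
  · obtain rfl := hr i ha
    exact Or.inl oddParity.map_one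
  rcases b with j | j
  · obtain rfl := hr j hb
    exact Or.inr evenParity.map_one
  have hij : ∀ i j : ℤ, j - i = i - j → i = j := by omega
  obtain rfl := hij i j (r.inj hab)
  change zmodCast i + 1 = 0 ∨ zmodCast i = 0
  generalize zmodCast i = u
  revert u
  decide

end DihedralGroup

namespace CoxeterSystem

variable {B W : Type*} [Group W] {M : CoxeterMatrix B}

theorem exists_basis_abelianization (cs : CoxeterSystem M W) (hM : M.IsRightAngled)
    [Module (ZMod 2) (Additive (Abelianization W))] :
    ∃ b : Module.Basis B (ZMod 2) (Additive (Abelianization W)),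
      ∀ s, b s = Additive.ofMul (Abelianization.of (cs.simple s)) := by
  classical
  let v : B → Additive (Abelianization W) := fun s => .ofMul (.of (cs.simple s))
  let f : B → Multiplicative (B →₀ ZMod 2) := fun s => .ofAdd (Finsupp.single s 1)
  have hsq : ∀ x : Multiplicative (B →₀ ZMod 2), x * x = 1 := fun x =>
    CharTwo.add_self_eq_zero (R := ZMod 2) |> fun h => by
      change x.toAdd + x.toAdd = 0
      ext s
      exact h _
  have hf : M.IsLiftable f := by
    intro s t
    rcases hM s t with h | h | h
    · have : s = t := by
        by_contra hne
        exact M.off_diagonal s t hne h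
      rw [this, hsq, one_pow]
    · rw [h, pow_two, hsq]
    · rw [h, pow_zero]
  let ψ : Additive (Abelianization W) →ₗ[ZMod 2] (B →₀ ZMod 2) :=
    (MonoidHom.toAdditiveLeft (Abelianization.lift (cs.lift ⟨f, hf⟩))).toZModLinearMap 2
  have hψ : ∀ s, ψ (v s) = Finsupp.single s 1 := by
    intro s
    change Multiplicative.toAdd (Abelianization.lift (cs.lift ⟨f, hf⟩) (.of (cs.simple s))) = _
    rw [Abelianization.lift_apply_of, cs.lift_apply_simple]
    rfl
  have hli : LinearIndependent (ZMod 2) v := by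
    refine LinearIndependent.of_comp ψ ?_
    convert (Finsupp.basisSingleOne (R := ZMod 2) (ι := B)).linearIndependent using 1
    funext s
    simp [hψ]
  have hsp : ⊤ ≤ Submodule.span (ZMod 2) (Set.range v) := by
    rintro x -
    obtain ⟨w, hw⟩ := QuotientGroup.mk_surjective x.toMul
    obtain rfl : x = .ofMul (.of w) := congrArg Additive.ofMul hw.symm
    induction w using cs.simple_induction with
    | simple s => exact Submodule.subset_span ⟨s, rfl⟩
    | one =>
      rw [map_one, ofMul_one]
      exact Submodule.zero_mem _
    | mul w w' h h' =>
      rw [map_mul, ofMul_mul]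
      exact Submodule.add_mem _ (h rfl) (h' rfl)
  exact ⟨Module.Basis.mk hli hsp, fun s => Module.Basis.mk_apply hli hsp s⟩

/-- Commuting involutions of `W` have images in the abelianization that are supported on a common
clique. -/
theorem ne_zero_of_commute (cs : CoxeterSystem M W) (hM : M.IsRightAngled)
    [Module (ZMod 2) (Additive (Abelianization W))]
    {β : Module.Basis B (ZMod 2) (Additive (Abelianization W))}
    (hβ : ∀ s, β s = .ofMul (.of (cs.simple s))) {a b : W} (ha : a * a = 1) (hb : b * b = 1)
    (hab : Commute a b) {p q : B} (hp : β.repr (.ofMul (.of a)) p ≠ 0)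
    (hq : β.repr (.ofMul (.of b)) q ≠ 0) : M p q ≠ 0 := by
  classical
  intro hpq
  have hne : p ≠ q := by
    rintro rfl
    simp at hpq
  have hqp : M q p = 0 := by rw [M.symmetric q p, hpq]
  let f : B → DihedralGroup 0 := fun s =>
    if s = p then DihedralGroup.sr 0 else if s = q then DihedralGroup.sr 1 else 1
  have hsq : ∀ s, f s * f s = 1 := by
    intro s
    simp only [f]
    split_ifs <;> simp
  have hf : M.IsLiftable f := by
    intro s t
    rcases hM s t with h | h | h
    · have : s = t := by
        by_contra hne
        exact M.off_diagonal s t hne h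
      rw [this, hsq, one_pow]
    · have : Commute (f s) (f t) := by
        have h1 : ∀ u, u ≠ p → u ≠ q → f u = 1 := fun u h1 h2 => by simp [f, h1, h2]
        by_cases hs : s ≠ p ∧ s ≠ q
        · rw [h1 s hs.1 hs.2]
          exact Commute.one_left _
        by_cases ht : t ≠ p ∧ t ≠ q
        · rw [h1 t ht.1 ht.2]
          exact Commute.one_right _
        have : s = t := by
          by_contra hst
          have : (s = p ∧ t = q) ∨ (s = q ∧ t = p) := by grind
          rcases this with ⟨rfl, rfl⟩ | ⟨rfl, rfl⟩ <;> omega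
        rw [this]
      rw [h, this.mul_pow, pow_two, pow_two, hsq, hsq, one_mul]
    · rw [h, pow_zero]
  let δ : W →* DihedralGroup 0 := cs.lift ⟨f, hf⟩
  have hδ : ∀ s, δ (cs.simple s) = f s := fun s => cs.lift_apply_simple hf s
  let χ : B → W →* Multiplicative (ZMod 2) := fun u =>
    { toFun := fun w => .ofAdd (β.repr (.ofMul (.of w)) u)
      map_one' := by simp
      map_mul' := by simp }
  have hχ : ∀ u s, χ u (cs.simple s) = .ofAdd (if s = u then 1 else 0) := by
    intro u s
    change Multiplicative.ofAdd (β.repr (.ofMul (.of (cs.simple s))) u) = _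
    rw [← hβ, Module.Basis.repr_self, Finsupp.single_apply]
  have hχp : χ p = DihedralGroup.oddParity.comp δ := by
    refine cs.ext_simple fun s => ?_
    rw [hχ, MonoidHom.comp_apply, hδ]
    simp only [f]
    split_ifs
    all_goals rfl
  have hχq : χ q = DihedralGroup.evenParity.comp δ := by
    refine cs.ext_simple fun s => ?_
    rw [hχ, MonoidHom.comp_apply, hδ]
    simp only [f]
    split_ifs with h1 h2
    · exact absurd (h2.symm.trans h1) hne
    all_goals rfl
  have := DihedralGroup.parity_eq_one_of_commute (a := δ a) (b := δ b)
    (by rw [← map_mul, ha, map_one]) (by rw [← map_mul, hb, map_one]) (hab.map δ)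
  rw [← MonoidHom.comp_apply, ← MonoidHom.comp_apply, ← hχp, ← hχq] at this
  exact this.elim hp hq

/-- Vectors supported on a clique lift to the subgroup generated by the clique. -/
theorem exists_mem_closure_of_mem_span (cs : CoxeterSystem M W)
    [Module (ZMod 2) (Additive (Abelianization W))]
    {β : Module.Basis B (ZMod 2) (Additive (Abelianization W))}
    (hβ : ∀ s, β s = .ofMul (.of (cs.simple s))) {K : Set B} {x : Additive (Abelianization W)}
    (hx : ∀ s, β.repr x s ≠ 0 → s ∈ K) :
    ∃ a ∈ Subgroup.closure (cs.simple '' K), Additive.ofMul (Abelianization.of a) = x := by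
  replace hx : x ∈ Submodule.span (ZMod 2) (β '' K) := by
    rw [Module.Basis.mem_span_image]
    exact fun s hs => hx s (Finsupp.mem_support_iff.mp hs)
  induction hx using Submodule.span_induction with
  | mem x hx =>
    obtain ⟨s, hs, rfl⟩ := hx
    exact ⟨cs.simple s, Subgroup.subset_closure ⟨s, hs, rfl⟩, (hβ s).symm⟩
  | zero => exact ⟨1, one_mem _, rfl⟩
  | add x y _ _ hx hy =>
    obtain ⟨a, ha, rfl⟩ := hx
    obtain ⟨b, hb, rfl⟩ := hy
    exact ⟨a * b, mul_mem ha hb, rfl⟩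
  | smul c x _ hx =>
    obtain ⟨a, ha, rfl⟩ := hx
    obtain rfl | rfl : c = 0 ∨ c = 1 := by
      revert c
      decide
    · exact ⟨1, one_mem _, by rw [zero_smul]; rfl⟩
    · exact ⟨a, ha, by rw [one_smul]⟩

theorem commute_of_mem_closure (cs : CoxeterSystem M W) (hM : M.IsRightAngled) {K : Set B}
    (hK : ∀ s ∈ K, ∀ t ∈ K, M s t ≠ 0) {a b : W} (ha : a ∈ Subgroup.closure (cs.simple '' K))
    (hb : b ∈ Subgroup.closure (cs.simple '' K)) : Commute a b := by
  induction ha, hb using Subgroup.closure_induction₂ with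
  | mem x y hx hy =>
    obtain ⟨s, hs, rfl⟩ := hx
    obtain ⟨t, ht, rfl⟩ := hy
    exact cs.simple_commute_of_ne_zero hM (hK s hs t ht)
  | one_left => exact Commute.one_left _
  | one_right => exact Commute.one_right _
  | mul_left x y z _ _ _ h1 h2 => exact h1.mul_left h2
  | mul_right y z x _ _ _ h1 h2 => exact h1.mul_right h2
  | inv_left x y _ _ h => exact h.inv_left
  | inv_right x y _ _ h => exact h.inv_right

theorem mul_self_eq_one_of_mem_closure (cs : CoxeterSystem M W) (hM : M.IsRightAngled) {K : Set B}
    (hK : ∀ s ∈ K, ∀ t ∈ K, M s t ≠ 0) {a : W} (ha : a ∈ Subgroup.closure (cs.simple '' K)) :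
    a * a = 1 := by
  induction ha using Subgroup.closure_induction with
  | mem x hx =>
    obtain ⟨s, hs, rfl⟩ := hx
    exact cs.simple_mul_simple_self s
  | one => exact one_mul 1
  | mul x y hx hy h1 h2 =>
    rw [(cs.commute_of_mem_closure hM hK hy hx).mul_mul_mul_comm, h1, h2, one_mul]
  | inv x _ h => rw [← mul_inv_rev, h, inv_one]

theorem isCliqueRel_abelianization (cs : CoxeterSystem M W) (hM : M.IsRightAngled)
    [Module (ZMod 2) (Additive (Abelianization W))]
    {β : Module.Basis B (ZMod 2) (Additive (Abelianization W))}
    (hβ : ∀ s, β s = .ofMul (.of (cs.simple s))) :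
    IsCliqueRel β (fun s t => M s t ≠ 0) fun x y => ∃ a b : W, a * a = 1 ∧ b * b = 1 ∧
      Commute a b ∧ Additive.ofMul (Abelianization.of a) = x ∧
        Additive.ofMul (Abelianization.of b) = y := by
  intro x y
  constructor
  · rintro ⟨a, b, ha, hb, hab, rfl, rfl⟩ s t (hs | hs) (ht | ht)
    · exact cs.ne_zero_of_commute hM hβ ha ha (Commute.refl a) hs ht
    · exact cs.ne_zero_of_commute hM hβ ha hb hab hs ht
    · exact cs.ne_zero_of_commute hM hβ hb ha hab.symm hs ht
    · exact cs.ne_zero_of_commute hM hβ hb hb (Commute.refl b) hs ht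
  · intro h
    let K : Set B := {s | β.repr x s ≠ 0 ∨ β.repr y s ≠ 0}
    have hK : ∀ s ∈ K, ∀ t ∈ K, M s t ≠ 0 := fun s hs t ht => h s t hs ht
    obtain ⟨a, ha, hax⟩ := cs.exists_mem_closure_of_mem_span hβ (K := K) (x := x) fun s => Or.inl
    obtain ⟨b, hb, hby⟩ := cs.exists_mem_closure_of_mem_span hβ (K := K) (x := y) fun s => Or.inr
    exact ⟨a, b, cs.mul_self_eq_one_of_mem_closure hM hK ha,
      cs.mul_self_eq_one_of_mem_closure hM hK hb, cs.commute_of_mem_closure hM hK ha hb, hax, hby⟩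

/-- Two right-angled Coxeter systems for the same group have isomorphic Coxeter matrices. -/
theorem isomorphic_of_isRightAngled {B' : Type*} {M' : CoxeterMatrix B'} (cs : CoxeterSystem M W)
    (hM : M.IsRightAngled) (cs' : CoxeterSystem M' W) (hM' : M'.IsRightAngled) :
    M.Isomorphic M' := by
  have htwo : ∀ x : Additive (Abelianization W), 2 • x = 0 := by
    intro x
    obtain ⟨w, hw⟩ := QuotientGroup.mk_surjective x.toMul
    obtain rfl : x = .ofMul (.of w) := congrArg Additive.ofMul hw.symm
    clear hw
    induction w using cs.simple_induction with
    | simple s => rw [← ofMul_pow, ← map_pow, cs.simple_sq, map_one, ofMul_one]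
    | one => rw [map_one, ofMul_one, smul_zero]
    | mul w w' h h' => rw [map_mul, ofMul_mul, smul_add, h, h', add_zero]
  let : Module (ZMod 2) (Additive (Abelianization W)) := AddCommGroup.zmodModule htwo
  obtain ⟨β, hβ⟩ := cs.exists_basis_abelianization hM
  obtain ⟨β', hβ'⟩ := cs'.exists_basis_abelianization hM'
  obtain ⟨e, he⟩ := exists_equiv_of_isCliqueRel (cs.isCliqueRel_abelianization hM hβ)
    (fun s => by simp) (fun s t h => by rwa [M.symmetric t s])
    (cs'.isCliqueRel_abelianization hM' hβ') (fun s => by simp)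
    (fun s t h => by rwa [M'.symmetric t s])
  refine ⟨e, fun s t => ?_⟩
  by_cases hst : s = t
  · rw [hst, M.diagonal, M'.diagonal]
  · have h1 := M.off_diagonal s t hst
    have h2 := M'.off_diagonal (e s) (e t) fun h => hst (e.injective h)
    have h3 := he s t
    rcases hM s t with h | h | h <;> rcases hM' (e s) (e t) with h' | h' | h' <;> simp_all

end CoxeterSystem

theorem IsCoxeterSet.isRightAngled {W : Type*} [Group W] (hW : IsRightAngledCoxeterGroup W)
    {S : Set W} (hS : IsCoxeterSet S) : hS.type.IsRightAngled := by
  obtain ⟨T, hT, hM⟩ := hW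
  obtain ⟨cs, -⟩ := hT.presentation
  intro s t
  change orderOf ((s : W) * t) = 1 ∨ orderOf ((s : W) * t) = 2 ∨ orderOf ((s : W) * t) = 0
  by_cases h : IsOfFinOrder ((s : W) * t)
  · have := orderOf_dvd_of_pow_eq_one
      ((pow_two _).trans (cs.mul_self_eq_one_of_isOfFinOrder hM h))
    rcases (Nat.dvd_prime Nat.prime_two).mp this with h | h
    · exact Or.inl h
    · exact Or.inr (Or.inl h)
  · exact Or.inr (Or.inr (orderOf_eq_zero h))

theorem mainTheorem1 {W : Type*} [Group W] (hW : IsRightAngledCoxeterGroup W) :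
    IsRigid W ∧
      ∀ S S' : Set W, IsCoxeterSet S → IsCoxeterSet S' → ∃ α : W ≃* W, α '' S = S' := by
  have hrigid : IsRigid W := by
    intro S S' hS hS'
    obtain ⟨cs, -⟩ := hS.presentation
    obtain ⟨cs', -⟩ := hS'.presentation
    exact cs.isomorphic_of_isRightAngled (hS.isRightAngled hW) cs' (hS'.isRightAngled hW)
  refine ⟨hrigid, fun S S' hS hS' => ?_⟩
  obtain ⟨e, he⟩ := hrigid S S' hS hS'
  obtain ⟨cs, hcs⟩ := hS.presentation
  obtain ⟨cs', hcs'⟩ := hS'.presentation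
  have hf : (hS.type).IsLiftable fun s => ((e s : S') : W) := by
    intro s t
    rw [← he]
    exact pow_orderOf_eq_one _
  have hg : (hS'.type).IsLiftable fun s => ((e.symm s : S) : W) := by
    intro s t
    have := he (e.symm s) (e.symm t)
    rw [e.apply_symm_apply, e.apply_symm_apply] at this
    rw [this]
    exact pow_orderOf_eq_one _
  let F : W →* W := cs.lift ⟨_, hf⟩
  let G : W →* W := cs'.lift ⟨_, hg⟩
  have hF : ∀ s : S, F s = e s := fun s => by
    conv_lhs => rw [← hcs s]
    exact cs.lift_apply_simple hf s
  have hG : ∀ s : S', G s = e.symm s := fun s => by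
    conv_lhs => rw [← hcs' s]
    exact cs'.lift_apply_simple hg s
  refine ⟨F.toMulEquiv G (cs.ext_simple fun s => ?_) (cs'.ext_simple fun s => ?_), ?_⟩
  · simp [hcs, hF, hG]
  · simp [hcs', hF, hG]
  · ext w
    constructor
    · rintro ⟨s, hs, rfl⟩
      exact (hF ⟨s, hs⟩).symm ▸ (e ⟨s, hs⟩).2
    · intro hw
      refine ⟨e.symm ⟨w, hw⟩, (e.symm ⟨w, hw⟩).2, ?_⟩
      exact (hF _).trans (by rw [e.apply_symm_apply])
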